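/- **Model.** A node-output message-passing GNN for $n$-node graphs with precision $p$ and depth $d$ has states that are vectors of $p$-bit variables. All graphs are simple and undirected, with node set $\{1,\dots,n\}$, and a node's number serves as its unique identifier. Starting from node attributes $x_i^{(0)}=a_i$, layer $\ell=1,\dots,d$ computes $$x_i^{(\ell)}=\mathrm{Up}_\ell\Big(\sum_{j\in N(i)\cup\{i\}}\mathrm{Msg}_\ell\big(x_i^{(\ell-1)},x_j^{(\ell-1)},i,j,a_{i\leftarrow j}\big)\Big),$$ and the output of node $i$ is $x_i^{(d)}$. Here $N(i)$ is the set of neighbors of $i$, the $a_{i\leftarrow j}$ are real vectors (edge attributes), $\mathrm{Msg}_\ell$ and $\mathrm{Up}_\ell$ are arbitrary functions, and messages are real vectors of arbitrary dimension. The width is the largest dimension of a state $x_i^{(\ell)}$, $0\le\ell\le d$. The node and edge attributes carry only identifying information: $a_i$ and $a_{i\leftarrow j}$ are arbitrary functions of the identifiers $i$, respectively $(i,j)$, that do not depend on the graph. **Statement.** Let $p=p(n)=\Theta(\log n)$ and let $w$ be a constant. There are $c>0$ and $n_0$ such that the following holds for every $n\ge n_0$, every such GNN for $n$-node graphs with precision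 $p(n)$, width at most $w$ and depth $$d< c\,\frac{n^2}{\log^2 n},$$ and every choice of attributes as above. For each of the following three problems, and for every fixed rule that reads the answer of a node off its output vector, there is a connected graph $G$ on $n$ nodes on which the GNN does not solve the problem exactly: 1. *minimum vertex cover*: the nodes whose output vectors lie in a fixed set $A$ of accepting vectors do not form a vertex cover of $G$ of minimum cardinality; 2. *maximum independent set*: the nodes whose output vectors lie in a fixed set $A$ of accepting vectors do not form an independent set of $G$ of maximum cardinality; 3. *minimum (perfect) coloring*: labeling each node $i$ by $\kappa(x_i^{(d)})$, for a fixed map $\kappa$ from output vectors to colors, does not give a proper coloring of $G$ with the smallest possible number of colors. That is, every constant-width GNN that exactly solves one of these problems on all connected $n$-node graphs has depth $\Omega(n^2/\log^2 n)$. -/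

import Mathlib

/-- Binary strings of length `p`: one variable stored with `p` bits of precision. -/
abbrev Word (p : ℕ) : Type := Fin p → Bool

/-- A `k`-dimensional vector of variables, each of which is stored with `p` bits. -/
abbrev WordVec (p k : ℕ) : Type := Fin k → Word p

/-- A message-passing graph neural network without readout (one output vector per node), for
graphs on `n` nodes with identifiers in `Fin n`, whose states are vectors of `p`-bit variables.
The messaging and the update functions are arbitrary functions, and the dimension of the messages
is unrestricted. Layer `ℓ + 1` of the network consists of `msg ℓ` and `up ℓ`; only the layers
`1, …, depth` are used. -/
structure GNN (n p : ℕ) where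
  /-- the number of layers -/
  depth : ℕ
  /-- `dim ℓ` is the dimension of the node states after layer `ℓ` (`ℓ = 0`: of the input) -/
  dim : ℕ → ℕ
  /-- the dimension of the edge attributes -/
  edgeDim : ℕ
  /-- the dimensions of the messages -/
  msgDim : ℕ → ℕ
  /-- the messaging functions `msg ℓ xᵢ xⱼ vᵢ vⱼ aᵢⱼ` -/
  msg : (ℓ : ℕ) → WordVec p (dim ℓ) → WordVec p (dim ℓ) → Fin n → Fin n →
    (Fin edgeDim → ℝ) → (Fin (msgDim ℓ) → ℝ)
  /-- the update functions -/
  up : (ℓ : ℕ) → (Fin (msgDim ℓ) → ℝ) → WordVec p (dim (ℓ + 1))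

namespace GNN

variable {n p : ℕ}

/-- The width: the largest dimension of a state, over all layers (the input included). -/
def width (N : GNN n p) : ℕ := (Finset.range (N.depth + 1)).sup N.dim

open scoped Classical in
/-- `N.state G a e ℓ i` is the state of node `i` after `ℓ` layers, on the graph `G` with node
attributes `a` and edge attributes `e` (`e i j` is the attribute of the edge from `j` to `i`). The
messages are summed over the neighbors of `i` and `i` itself. -/
noncomputable def state (N : GNN n p) (G : SimpleGraph (Fin n))
    (a : Fin n → WordVec p (N.dim 0)) (e : Fin n → Fin n → Fin N.edgeDim → ℝ) :
    (ℓ : ℕ) → Fin n → WordVec p (N.dim ℓ)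
  | 0 => a
  | ℓ + 1 => fun i => N.up ℓ
      (∑ j with j = i ∨ G.Adj i j, N.msg ℓ (N.state G a e ℓ i) (N.state G a e ℓ j) i j (e i j))

/-- The output of the network: the states of the nodes after the last layer. -/
noncomputable def output (N : GNN n p) (G : SimpleGraph (Fin n))
    (a : Fin n → WordVec p (N.dim 0)) (e : Fin n → Fin n → Fin N.edgeDim → ℝ) :
    Fin n → WordVec p (N.dim N.depth) :=
  N.state G a e N.depth

open scoped Classical in
/-- The set of nodes that the network selects, when a node counts as selected if and only if its
output vector lies in `A`. -/
noncomputable def selected (N : GNN n p) (G : SimpleGraph (Fin n))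
    (a : Fin n → WordVec p (N.dim 0)) (e : Fin n → Fin n → Fin N.edgeDim → ℝ)
    (A : Set (WordVec p (N.dim N.depth))) : Finset (Fin n) :=
  {i | N.output G a e i ∈ A}

end GNN

/-- `S` is a vertex cover of `G` of minimum cardinality. -/
def IsMinVertexCover {V : Type} (G : SimpleGraph V) (S : Finset V) : Prop :=
  G.IsVertexCover (S : Set V) ∧ ∀ T : Finset V, G.IsVertexCover (T : Set V) → S.card ≤ T.card

/-- `f` is a proper coloring of `G` that uses the smallest possible number of colors. -/
def IsPerfectColoring {V C : Type} (G : SimpleGraph V) (f : V → C) : Prop :=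
  (∀ u v, G.Adj u v → f u ≠ f v) ∧ (Set.range f).encard = G.chromaticNumber

/-! The obstruction is two-party communication. A graph is assembled from two halves that encode
`2^t × 2^t` Boolean matrices `x` and `y` and touch only in cores of `O(t)` nodes, so runs on two
such graphs can be spliced whenever their core states agree (`state_glue`). The gadgets make the
independence number and the chromatic number reveal whether `x` and `y` have a common `true` entry:
rows are tied to their binary addresses, and the doubled core edges force both halves to select the
same addresses.

The pairs `(x, ¬x)` form a fooling set of size `2 ^ 4 ^ t` for disjointness. With fewer transcripts,
some `x ≠ x'` share one; then `(x, ¬x)`, `(x', ¬x')` and both mixtures get the same output, although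
one mixture has a common entry (`exists_fooling_glue`). One answer cannot be optimal with and
without a common entry. A transcript has about `p w (t d + n)` bits. With `2^t = Θ(n)` and `p, t =
O(log n)`, this stays below `4^t = Θ(n²)` until `d` is of order `n² / log² n`. Only states are
recorded, so the messages may be arbitrarily large. -/

namespace GNN

/-! ### Splicing runs along a cut and counting transcripts -/

variable {n p : ℕ}

theorem dim_le_width (N : GNN n p) {ℓ : ℕ} (h : ℓ ≤ N.depth) : N.dim ℓ ≤ N.width :=
  Finset.le_sup (f := N.dim) (Finset.mem_range.2 (Nat.lt_succ_of_le h))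

/-- Two-party simulation: if `H` agrees with `G` around the nodes on the `true` side and with `G'`
around the nodes on the `false` side, and the states of the cut nodes agree in the runs on `G` and
`G'`, then the run on `H` is glued from the runs on `G` and `G'`. -/
theorem state_glue (N : GNN n p) (a : Fin n → WordVec p (N.dim 0))
    (e : Fin n → Fin n → Fin N.edgeDim → ℝ) (side : Fin n → Bool) (cut : Finset (Fin n))
    {G G' H : SimpleGraph (Fin n)}
    (hG : ∀ i j, side i = true → (H.Adj i j ↔ G.Adj i j))
    (hG' : ∀ i j, side i = false → (H.Adj i j ↔ G'.Adj i j))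
    (hcut : ∀ i j, H.Adj i j → side i ≠ side j → j ∈ cut) {d : ℕ}
    (hstate : ∀ ℓ < d, ∀ i ∈ cut, N.state G a e ℓ i = N.state G' a e ℓ i) :
    ∀ ℓ ≤ d, ∀ i, N.state H a e ℓ i = if side i = true then N.state G a e ℓ i
      else N.state G' a e ℓ i := by
  classical
  intro ℓ
  induction ℓ with
  | zero => intro _ i; simp [state]
  | succ ℓ ih =>
    intro hℓ i
    have ih := ih (by omega)
    have key : ∀ j, H.Adj i j → N.state H a e ℓ j =
        if side i = true then N.state G a e ℓ j else N.state G' a e ℓ j := by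
      intro j hij
      rw [ih j]
      by_cases hs : side i = side j
      · rw [hs]
      -- Only cut nodes send messages across, and their states are the same in both runs.
      · have := hstate ℓ (by omega) j (hcut i j hij hs)
        split_ifs <;> simp [this]
    cases hi : side i with
    | true =>
      simp only [if_true, state]
      congr 1
      refine Finset.sum_congr (Finset.filter_congr fun j _ => by rw [hG i j hi]) fun j hj => ?_
      have hj' : N.state H a e ℓ j = N.state G a e ℓ j := by
        rcases (Finset.mem_filter.1 hj).2 with rfl | hj
        · rw [ih, if_pos hi]
        · rw [key j ((hG i j hi).2 hj), if_pos hi]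
      rw [hj', ih i, if_pos hi]
    | false =>
      simp only [state]
      rw [if_neg (by simp)]
      congr 1
      refine Finset.sum_congr (Finset.filter_congr fun j _ => by rw [hG' i j hi]) fun j hj => ?_
      have hj' : N.state H a e ℓ j = N.state G' a e ℓ j := by
        rcases (Finset.mem_filter.1 hj).2 with rfl | hj
        · rw [ih, if_neg (by simp [hi])]
        · rw [key j ((hG' i j hi).2 hj), if_neg (by simp [hi])]
      rw [hj', ih i, if_neg (by simp [hi])]

/-- The states of the cut nodes in all layers but the last, and the output of all nodes. -/
abbrev Transcript (N : GNN n p) (cut : Finset (Fin n)) : Type :=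
  ((ℓ : Fin N.depth) → cut → WordVec p (N.dim ℓ)) × (Fin n → WordVec p (N.dim N.depth))

/-- Recording the outputs of all nodes, not only of the cut, costs just `p * w * n` bits. -/
theorem card_transcript_le (N : GNN n p) (cut : Finset (Fin n)) {w : ℕ} (hw : N.width ≤ w) :
    Fintype.card (N.Transcript cut) ≤ 2 ^ (p * w * (cut.card * N.depth + n)) := by
  have hvec : ∀ ℓ ≤ N.depth, Fintype.card (WordVec p (N.dim ℓ)) ≤ 2 ^ (p * w) := by
    intro ℓ hℓ
    simp only [Fintype.card_pi, Fintype.card_bool, Finset.prod_const, Finset.card_univ,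
      Fintype.card_fin, ← pow_mul]
    exact Nat.pow_le_pow_right (by norm_num)
      (Nat.mul_le_mul_left _ ((N.dim_le_width hℓ).trans hw))
  rw [Fintype.card_prod, mul_add, pow_add]
  refine Nat.mul_le_mul ?_ ?_
  · rw [Fintype.card_pi]
    refine (Finset.prod_le_pow_card _ _ (2 ^ (p * w * cut.card)) fun ℓ _ => ?_).trans ?_
    · rw [Fintype.card_fun, Fintype.card_coe, pow_mul]
      exact Nat.pow_le_pow_left (hvec ℓ ℓ.2.le) _
    · simp [← pow_mul, mul_assoc]
  · rw [Fintype.card_fun, Fintype.card_fin, pow_mul]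
    exact Nat.pow_le_pow_left (hvec _ le_rfl) _

/-- The fooling argument: if there are more inputs than transcripts, then the network has the
same output on the two graphs of some pair of inputs and on both graphs mixed from them. -/
theorem exists_fooling_pair (N : GNN n p) (a : Fin n → WordVec p (N.dim 0))
    (e : Fin n → Fin n → Fin N.edgeDim → ℝ) (side : Fin n → Bool) (cut : Finset (Fin n))
    {X Y : Type*} [Fintype X] (G : X → Y → SimpleGraph (Fin n)) (φ : X → Y)
    (hG : ∀ i j x y y', side i = true → ((G x y).Adj i j ↔ (G x y').Adj i j))
    (hG' : ∀ i j x x' y, side i = false → ((G x y).Adj i j ↔ (G x' y).Adj i j))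
    (hcut : ∀ i j x y, (G x y).Adj i j → side i ≠ side j → j ∈ cut) {w : ℕ}
    (hw : N.width ≤ w)
    (hcard : 2 ^ (p * w * (cut.card * N.depth + n)) < Fintype.card X) :
    ∃ x x', x ≠ x' ∧ N.output (G x' (φ x')) a e = N.output (G x (φ x)) a e ∧
      N.output (G x (φ x')) a e = N.output (G x (φ x)) a e ∧
      N.output (G x' (φ x)) a e = N.output (G x (φ x)) a e := by
  let T : X → N.Transcript cut := fun x =>
    (fun ℓ i => N.state (G x (φ x)) a e ℓ i, N.output (G x (φ x)) a e)
  obtain ⟨x, x', hne, hT⟩ :=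
    Fintype.exists_ne_map_eq_of_card_lt T ((N.card_transcript_le cut hw).trans_lt hcard)
  have hout : N.output (G x (φ x)) a e = N.output (G x' (φ x')) a e := congrArg Prod.snd hT
  have hst : ∀ ℓ < N.depth, ∀ i ∈ cut,
      N.state (G x (φ x)) a e ℓ i = N.state (G x' (φ x')) a e ℓ i := fun ℓ hℓ i hi =>
    congrFun (congrFun (congrArg Prod.fst hT) ⟨ℓ, hℓ⟩) ⟨i, hi⟩
  refine ⟨x, x', hne, hout.symm, ?_, ?_⟩ <;> funext i
  · refine (N.state_glue a e side cut (fun i j h => hG i j _ _ _ h) (fun i j h => hG' i j _ _ _ h)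
      (fun i j => hcut i j _ _) hst N.depth le_rfl i).trans ?_
    have := congrFun hout i
    unfold output at this ⊢
    split_ifs <;> simp [this]
  · refine (N.state_glue a e side cut (fun i j h => hG i j _ _ _ h) (fun i j h => hG' i j _ _ _ h)
      (fun i j => hcut i j _ _) (fun ℓ hℓ i hi => (hst ℓ hℓ i hi).symm) N.depth le_rfl i).trans ?_
    have := congrFun hout i
    unfold output at this ⊢
    split_ifs <;> simp [this]

end GNN

/-! ### The lower-bound graphs -/

/-- The colors of the palette: a hub color, a selection color `some none`, and one color for each
bit position of each of the two row indices. -/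
abbrev Color (t : ℕ) : Type := Option (Option (Bool × Fin t))

/-- The nodes of one half of the lower-bound graphs. The core consists of the palette nodes and of
the bit nodes `(s, h, b)`, the latter standing for "bit `h` of index `s` is `b`"; the other nodes
are the rows `(s, i)`, standing for "index `s` is `i`". -/
abbrev Node (t : ℕ) : Type := (Color t ⊕ Bool × Fin t × Bool) ⊕ Bool × (Fin t → Bool)

/-- An input of a party: a Boolean matrix with rows and columns indexed by bit strings. -/
abbrev Input (t : ℕ) : Type := (Fin t → Bool) → (Fin t → Bool) → Bool

/-- Two halves, on the inputs `x` and `y`, joined by doubling the edges inside the core; the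
vertices are labeled by a side and a node of that half. -/
def glue {t : ℕ} {W : Type*} (r : Input t → Node t → Node t → Prop) (lab : W → Bool × Node t)
    (x y : Input t) : SimpleGraph W :=
  SimpleGraph.fromRel fun u v =>
    r (if (lab u).1 then x else y) (lab u).2 (lab v).2 ∧
      ((lab u).1 = (lab v).1 ∨ (lab u).2.isLeft ∧ (lab v).2.isLeft)

/-- The adjacency pattern of a half for independent sets. -/
def indepRel {t : ℕ} (x : Input t) : Node t → Node t → Prop
  | .inl (.inl _), _ => True
  | .inl (.inr (s, h, b)), .inl (.inr (s', h', b')) => s = s' ∧ h = h' ∧ b ≠ b'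
  | .inr (s, i), .inl (.inr (s', h, b)) => s = s' ∧ b ≠ i h
  | .inr (s, i), .inr (s', j) => s = s' ∨ s = false ∧ s' = true ∧ x i j = false
  | _, _ => False

/-- The adjacency pattern of a half for colorings. -/
def colorRel {t : ℕ} (x : Input t) : Node t → Node t → Prop
  | .inl (.inl c), .inl (.inl c') => c ≠ c'
  | .inl (.inl c), .inl (.inr (s, h, _)) => c ≠ some none ∧ c ≠ some (some (s, h))
  | .inl (.inl c), .inr (s, _) => c ≠ some none ∧ ∀ h, c ≠ some (some (s, h))
  | .inl (.inr (s, h, b)), .inl (.inr (s', h', b')) => s = s' ∧ h = h' ∧ b ≠ b'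
  | .inr (s, i), .inl (.inr (s', h, b)) => s = s' ∧ b = i h
  | .inr (s, i), .inr (s', j) => s = false ∧ s' = true ∧ x i j = false
  | _, _ => False

/-- The pattern inside the core does not depend on the input. -/
def CoreIndep {t : ℕ} (r : Input t → Node t → Node t → Prop) : Prop :=
  ∀ x x' u v, r x (.inl u) (.inl v) ↔ r x' (.inl u) (.inl v)

/-- The hub is adjacent to all other nodes. -/
def HubDominates {t : ℕ} (r : Input t → Node t → Node t → Prop) : Prop :=
  ∀ x u, u ≠ .inl (.inl none) → r x (.inl (.inl none)) u

theorem coreIndep_indepRel {t : ℕ} : CoreIndep (indepRel (t := t)) := by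
  rintro x x' (c | ⟨s, h, b⟩) (c' | ⟨s', h', b'⟩) <;> rfl

theorem coreIndep_colorRel {t : ℕ} : CoreIndep (colorRel (t := t)) := by
  rintro x x' (c | ⟨s, h, b⟩) (c' | ⟨s', h', b'⟩) <;> rfl

theorem hubDominates_indepRel {t : ℕ} : HubDominates (indepRel (t := t)) := fun _ _ _ => trivial

theorem hubDominates_colorRel {t : ℕ} : HubDominates (colorRel (t := t)) := by
  rintro x ((c | ⟨s, h, b⟩) | ⟨s, i⟩) hu <;> simp_all [colorRel, eq_comm]

/-- A labeling that takes every label, and every label in the core only once. -/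
structure IsLabeling {t : ℕ} {W : Type*} (lab : W → Bool × Node t) : Prop where
  surjective : Function.Surjective lab
  injOn_core : ∀ u v, (lab u).2.isLeft → lab u = lab v → u = v

theorem card_label (t : ℕ) : Fintype.card (Bool × Node t) = 2 * (2 + 6 * t + 2 * 2 ^ t) := by
  simp only [Fintype.card_prod, Fintype.card_sum, Fintype.card_option, Fintype.card_bool,
    Fintype.card_fin, Fintype.card_fun]
  ring

theorem exists_isLabeling {t n : ℕ} (h : 2 * (2 + 6 * t + 2 * 2 ^ t) ≤ n) :
    ∃ lab : Fin n → Bool × Node t, IsLabeling lab := by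
  rw [← card_label] at h
  let e := Fintype.equivFin (Bool × Node t)
  -- Surplus vertices all copy one row, so they do not enlarge the core, which serves as the cut.
  refine ⟨fun u => if hu : u.1 < Fintype.card (Bool × Node t) then e.symm ⟨u, hu⟩
    else (true, .inr (true, fun _ => true)), fun v => ⟨⟨e v, (e v).2.trans_le h⟩, ?_⟩, ?_⟩
  · exact (dif_pos (e v).2).trans (e.symm_apply_apply v)
  · intro u v hu huv
    split_ifs at hu huv with h1 h2
    · simpa [Fin.ext_iff] using e.symm.injective huv
    · simp [huv] at hu
    · simp at hu
    · simp at hu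

section glue

variable {t : ℕ} {W : Type*} {r : Input t → Node t → Node t → Prop} {lab : W → Bool × Node t}

/-- An edge may also come from `r` read from `v` with the input of the side of `v`; if that is the
other side, both ends are in the core, where the input is irrelevant. -/
theorem glue_adj_congr_right (hr : CoreIndep r) {u : W} (hu : (lab u).1 = true) (v : W)
    (x y y' : Input t) : (glue r lab x y).Adj u v ↔ (glue r lab x y').Adj u v := by
  simp only [glue, SimpleGraph.fromRel_adj]
  generalize lab u = a at *
  generalize lab v = b at *
  obtain ⟨σ, a⟩ := a
  obtain ⟨τ, b⟩ := b
  cases τ <;> simp_all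
  intro _
  rcases a with a | a <;> rcases b with b | b <;> simp
  rw [hr y y']

theorem glue_adj_congr_left (hr : CoreIndep r) {u : W} (hu : (lab u).1 = false) (v : W)
    (x x' y : Input t) : (glue r lab x y).Adj u v ↔ (glue r lab x' y).Adj u v := by
  simp only [glue, SimpleGraph.fromRel_adj]
  generalize lab u = a at *
  generalize lab v = b at *
  obtain ⟨σ, a⟩ := a
  obtain ⟨τ, b⟩ := b
  cases τ <;> simp_all
  intro _
  rcases a with a | a <;> rcases b with b | b <;> simp
  rw [hr x x']

/-- The vertices with labels in the core. -/
noncomputable def coreSet [Fintype W] (lab : W → Bool × Node t) : Finset W :=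
  {u | (lab u).2.isLeft}

theorem mem_coreSet_of_glue_adj [Fintype W] {u v : W} {x y : Input t}
    (h : (glue r lab x y).Adj u v) (hside : (lab u).1 ≠ (lab v).1) : v ∈ coreSet lab := by
  simp only [glue, SimpleGraph.fromRel_adj] at h
  simp only [coreSet, Finset.mem_filter, Finset.mem_univ, true_and]
  grind

theorem IsLabeling.card_coreSet_le [Fintype W] (hlab : IsLabeling lab) :
    (coreSet lab).card ≤ 4 + 12 * t := by
  classical
  have hcard : Fintype.card (Bool × (Color t ⊕ Bool × Fin t × Bool)) = 4 + 12 * t := by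
    simp only [Fintype.card_prod, Fintype.card_sum, Fintype.card_option, Fintype.card_bool,
      Fintype.card_fin]
    ring
  rw [← hcard, ← Finset.card_univ]
  calc (coreSet lab).card = ((coreSet lab).image lab).card := by
        refine (Finset.card_image_of_injOn fun u hu v _ huv => hlab.injOn_core u v ?_ huv).symm
        simpa [coreSet] using hu
    _ ≤ (Finset.univ.image fun q : Bool × (Color t ⊕ Bool × Fin t × Bool) =>
          ((q.1, .inl q.2) : Bool × Node t)).card := by
        refine Finset.card_le_card fun q hq => ?_
        obtain ⟨u, hu, rfl⟩ := Finset.mem_image.1 hq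
        simp only [coreSet, Finset.mem_filter, Finset.mem_univ, true_and] at hu
        obtain ⟨c, hc⟩ := Sum.isLeft_iff.1 hu
        exact Finset.mem_image.2 ⟨((lab u).1, c), Finset.mem_univ _, by simp [← hc]⟩
    _ ≤ _ := Finset.card_image_le

theorem glue_adj_of_rel {u v : W} {x y : Input t} (hne : u ≠ v)
    (h : r (if (lab u).1 then x else y) (lab u).2 (lab v).2)
    (hs : (lab u).1 = (lab v).1 ∨ (lab u).2.isLeft ∧ (lab v).2.isLeft) :
    (glue r lab x y).Adj u v :=
  (SimpleGraph.fromRel_adj _ _ _).2 ⟨hne, Or.inl ⟨h, hs⟩⟩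

theorem IsLabeling.connected_glue (hlab : IsLabeling lab) (hr : HubDominates r)
    (x y : Input t) : (glue r lab x y).Connected := by
  choose g hg using hlab.surjective
  have hub : ∀ σ u, ((lab u).1 = σ ∨ (lab u).2.isLeft) → (lab u).2 ≠ .inl (.inl none) →
      (glue r lab x y).Reachable u (g (σ, .inl (.inl none))) := by
    intro σ u hs hu
    refine (SimpleGraph.Adj.reachable (glue_adj_of_rel ?_ ?_ ?_)).symm
    · rintro rfl
      simp [hg] at hu
    · rw [hg]
      exact hr _ _ hu
    · rw [hg]
      rcases hs with hs | hs <;> simp [hs]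
  -- The two hubs need not be adjacent, but both are adjacent to the palette node `some none` of
  -- either half.
  have cross : ∀ σ τ, (glue r lab x y).Reachable (g (σ, .inl (.inl none)))
      (g (τ, .inl (.inl none))) := fun σ τ =>
    (hub σ (g (σ, .inl (.inl (some none)))) (by simp [hg]) (by simp [hg])).symm.trans
      (hub τ (g (σ, .inl (.inl (some none)))) (by simp [hg]) (by simp [hg]))
  have all : ∀ u, (glue r lab x y).Reachable u (g (true, .inl (.inl none))) := by
    intro u
    by_cases hu : (lab u).2 = .inl (.inl none)
    · have : u = g ((lab u).1, .inl (.inl none)) :=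
        hlab.injOn_core _ _ (by simp [hu]) (by rw [hg, ← hu])
      rw [this]
      exact cross _ _
    · exact (hub _ u (.inl rfl) hu).trans (cross _ _)
  have : Nonempty W := ⟨g (true, .inl (.inl none))⟩
  exact ⟨fun u v => (all u).trans (all v).symm⟩

end glue

/-! ### Independent sets and common entries -/

section IndepSet

variable {t : ℕ} {W : Type*} {lab : W → Bool × Node t} {x y : Input t}

/-- The clique to which a label belongs, in a partition into `4 * (t + 1)` cliques. -/
def cliqueClass {t : ℕ} : Bool × Node t → Bool × Bool × Option (Fin t)
  | (σ, .inl (.inl _)) => (σ, false, none)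
  | (σ, .inl (.inr (s, h, _))) => (σ, s, some h)
  | (σ, .inr (s, _)) => (σ, s, none)

theorem card_cliqueClass (t : ℕ) :
    Fintype.card (Bool × Bool × Option (Fin t)) = 4 * (t + 1) := by
  simp only [Fintype.card_prod, Fintype.card_option, Fintype.card_bool, Fintype.card_fin]
  ring

/-- An independent set has at most one node in each of the `4 * (t + 1)` cliques, so here it meets
them all. Row-bit edges make the chosen bits spell the chosen row, core edges make the halves agree,
and row-row edges rule out `false` entries. -/
theorem IsLabeling.exists_common_of_isIndepSet (hlab : IsLabeling lab) {S : Finset W}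
    (hS : (glue indepRel lab x y).IsIndepSet S) (hcard : 4 * (t + 1) ≤ S.card) :
    ∃ i j, x i j = true ∧ y i j = true := by
  classical
  have hrel : ∀ u ∈ S, ∀ v ∈ S, ∀ σ τ a b, lab u = (σ, a) → lab v = (τ, b) →
      (σ = τ ∨ a.isLeft ∧ b.isLeft) → indepRel (if σ then x else y) a b → u = v := by
    intro u hu v hv σ τ a b ha hb hs hr
    by_contra hne
    refine hS hu hv hne (glue_adj_of_rel hne ?_ ?_) <;> simpa [ha, hb]
  have hinj : Set.InjOn (fun u => cliqueClass (lab u)) (S : Set W) := by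
    intro u hu v hv huv
    simp only at huv
    rcases hu' : lab u with ⟨σ, (c | ⟨s, h, b⟩) | ⟨s, i⟩⟩ <;>
    rcases hv' : lab v with ⟨τ, (c' | ⟨s', h', b'⟩) | ⟨s', i'⟩⟩ <;>
    simp only [hu', hv', cliqueClass, Prod.mk.injEq, reduceCtorEq, Option.some.injEq, and_false,
      and_true] at huv
    · exact hrel u hu v hv _ _ _ _ hu' hv' (.inl huv) trivial
    · exact hrel u hu v hv _ _ _ _ hu' hv' (.inl huv.1) trivial
    · obtain ⟨rfl, rfl, rfl⟩ := huv
      by_cases hb : b = b'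
      · subst hb
        exact hlab.injOn_core u v (by simp [hu']) (hu'.trans hv'.symm)
      · exact hrel u hu v hv _ _ _ _ hu' hv' (.inl rfl) ⟨rfl, rfl, hb⟩
    · exact (hrel v hv u hu _ _ _ _ hv' hu' (.inl huv.1.symm) trivial).symm
    · exact hrel u hu v hv _ _ _ _ hu' hv' (.inl huv.1) (.inl huv.2)
  have hsurj : ∀ q, ∃ u ∈ S, cliqueClass (lab u) = q := by
    have : S.image (fun u => cliqueClass (lab u)) = Finset.univ := by
      refine Finset.eq_univ_of_card _ (le_antisymm (Finset.card_le_univ _) ?_)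
      rwa [Finset.card_image_of_injOn hinj, card_cliqueClass]
    intro q
    simpa using this.ge (Finset.mem_univ q)
  -- A palette node would exclude the row of index `true` that its half must contribute.
  have hnopal : ∀ u ∈ S, ∀ σ c, lab u ≠ (σ, .inl (.inl c)) := by
    intro u hu σ c hc
    obtain ⟨v, hv, hq⟩ := hsurj (σ, true, none)
    rcases hv' : lab v with ⟨τ, (c' | ⟨s', h', b'⟩) | ⟨s', i'⟩⟩ <;>
      simp [hv', cliqueClass] at hq
    have := hrel u hu v hv _ _ _ _ hc hv' (.inl hq.1.symm) trivial
    subst this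
    simp [hv'] at hc
  have hrow : ∀ σ s, ∃ i, ∃ u ∈ S, lab u = (σ, .inr (s, i)) := by
    intro σ s
    obtain ⟨v, hv, hq⟩ := hsurj (σ, s, none)
    rcases hv' : lab v with ⟨τ, (c' | ⟨s', h', b'⟩) | ⟨s', i'⟩⟩
    · exact absurd hv' (hnopal v hv _ _)
    · simp [hv', cliqueClass] at hq
    · simp only [hv', cliqueClass, Prod.mk.injEq, and_true] at hq
      exact ⟨i', v, hv, by rw [hv', hq.1, hq.2]⟩
  have hbit : ∀ σ s h, ∃ b, ∃ u ∈ S, lab u = (σ, .inl (.inr (s, h, b))) := by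
    intro σ s h
    obtain ⟨v, hv, hq⟩ := hsurj (σ, s, some h)
    rcases hv' : lab v with ⟨τ, (c' | ⟨s', h', b'⟩) | ⟨s', i'⟩⟩
    · simp [hv', cliqueClass] at hq
    · simp only [hv', cliqueClass, Prod.mk.injEq, Option.some.injEq] at hq
      exact ⟨b', v, hv, by rw [hv', hq.1, hq.2.1, hq.2.2]⟩
    · simp [hv', cliqueClass] at hq
  choose I U hUS hU using hrow
  choose B V hVS hV using hbit
  have hIB : ∀ σ s h, B σ s h = I σ s h := by
    intro σ s h
    by_contra hne
    have := hrel _ (hUS σ s) _ (hVS σ s h) _ _ _ _ (hU σ s) (hV σ s h) (.inl rfl) ⟨rfl, hne⟩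
    have := (hU σ s).symm.trans ((congrArg lab this).trans (hV σ s h))
    simp at this
  have hBB : ∀ s h, B true s h = B false s h := by
    intro s h
    by_contra hne
    have := hrel _ (hVS true s h) _ (hVS false s h) _ _ _ _ (hV true s h) (hV false s h)
      (.inr ⟨rfl, rfl⟩) ⟨rfl, rfl, hne⟩
    have := (hV true s h).symm.trans ((congrArg lab this).trans (hV false s h))
    simp at this
  have hII : ∀ s, I true s = I false s := fun s => by
    funext h
    rw [← hIB, ← hIB, hBB]
  have hin : ∀ σ : Bool, (if σ then x else y) (I σ false) (I σ true) = true := by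
    intro σ
    by_contra hne
    have := hrel _ (hUS σ false) _ (hUS σ true) _ _ _ _ (hU σ false) (hU σ true) (.inl rfl)
      (.inr ⟨rfl, rfl, by simpa using hne⟩)
    have := (hU σ false).symm.trans ((congrArg lab this).trans (hU σ true))
    simp at this
  refine ⟨I true false, I true true, hin true, ?_⟩
  rw [hII, hII]
  exact hin false

theorem IsLabeling.exists_isIndepSet_of_common (hlab : IsLabeling lab)
    {i j : Fin t → Bool} (hx : x i j = true) (hy : y i j = true) :
    ∃ S : Finset W, (glue indepRel lab x y).IsIndepSet S ∧ S.card = 4 * (t + 1) := by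
  classical
  choose g hg using hlab.surjective
  let sel : Bool → Fin t → Bool := fun s => if s then j else i
  let m : Bool × Bool × Option (Fin t) → Bool × Node t := fun q =>
    match q with
    | (σ, s, none) => (σ, .inr (s, sel s))
    | (σ, s, some h) => (σ, .inl (.inr (s, h, sel s h)))
  have hm : Function.LeftInverse cliqueClass m := by
    rintro ⟨σ, s, _ | h⟩ <;> rfl
  have hginj : Function.Injective g := Function.LeftInverse.injective hg
  have hrel : ∀ q q', q ≠ q' → ¬ (indepRel (if (m q).1 then x else y) (m q).2 (m q').2 ∧
      ((m q).1 = (m q').1 ∨ (m q).2.isLeft ∧ (m q').2.isLeft)) := by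
    rintro ⟨σ, s, _ | h⟩ ⟨τ, s', _ | h'⟩ hne ⟨hr, hs⟩ <;>
      simp only [m, indepRel, Sum.isLeft] at hr hs
    · cases σ <;> cases s <;> cases s' <;> simp_all [sel]
    · obtain ⟨rfl, hr⟩ := hr
      exact hr rfl
    · obtain ⟨rfl, rfl, hr⟩ := hr
      exact hr rfl
  refine ⟨Finset.univ.image (g ∘ m), ?_, ?_⟩
  · intro u hu v hv hne hadj
    simp only [Finset.coe_image, Finset.coe_univ, Set.image_univ, Set.mem_range,
      Function.comp_apply] at hu hv
    obtain ⟨q, rfl⟩ := hu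
    obtain ⟨q', rfl⟩ := hv
    have hqq : q ≠ q' := fun h => hne (by rw [h])
    simp only [glue, SimpleGraph.fromRel_adj, hg] at hadj
    rcases hadj.2 with h | h
    · exact hrel q q' hqq h
    · exact hrel q' q hqq.symm h
  · rw [Finset.card_image_of_injective _ (hginj.comp hm.injective), Finset.card_univ,
      card_cliqueClass]

end IndepSet

/-! ### Colorings and common entries -/

section Coloring

variable {t : ℕ} {W : Type*} {lab : W → Bool × Node t} {x y : Input t}

theorem card_color (t : ℕ) : Fintype.card (Color t) = 2 * t + 2 := by
  simp only [Fintype.card_prod, Fintype.card_option, Fintype.card_bool, Fintype.card_fin]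

/-- The palettes name the colors, identically in both halves. Each bit pair gets its own color and
the selection color, in the same order in both halves. The row addressed by the bits with their own
color is left with the selection color only, so the two such rows of a half are not adjacent. -/
theorem IsLabeling.exists_common_of_coloring [Finite W] (hlab : IsLabeling lab)
    (f : (glue colorRel lab x y).Coloring (Color t)) : ∃ i j, x i j = true ∧ y i j = true := by
  choose g hg using hlab.surjective
  have hne : ∀ σ τ a b, g (σ, a) ≠ g (τ, b) → (σ = τ ∨ a.isLeft ∧ b.isLeft) →
      colorRel (if σ then x else y) a b → f (g (σ, a)) ≠ f (g (τ, b)) := by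
    intro σ τ a b h hs hr
    refine f.valid (glue_adj_of_rel h ?_ ?_) <;> simpa [hg]
  have hgne : ∀ q q', q ≠ q' → g q ≠ g q' := fun q q' h h' =>
    h (Function.LeftInverse.injective hg h')
  have hpal : ∀ σ τ c c', c ≠ c' → f (g (σ, .inl (.inl c))) ≠ f (g (τ, .inl (.inl c'))) :=
    fun σ τ c c' h => hne _ _ _ _ (hgne _ _ (by simp [h])) (.inr ⟨rfl, rfl⟩) h
  have hinj : Function.Injective fun c => f (g (true, .inl (.inl c))) := fun c c' h => by
    by_contra hc
    exact hpal true true c c' hc h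
  let P : Color t ≃ Color t := Equiv.ofBijective _ (Finite.injective_iff_bijective.1 hinj)
  have hP : ∀ c, P c = f (g (true, .inl (.inl c))) := fun c => rfl
  have hpal' : ∀ σ c, f (g (σ, .inl (.inl c))) = P c := by
    intro σ c
    obtain ⟨c', hc'⟩ := P.surjective (f (g (σ, .inl (.inl c))))
    rw [← hc']
    by_contra h
    exact hpal true σ c' c (fun h' => h (by rw [h'])) hc'
  have hbit : ∀ σ s h b, f (g (σ, .inl (.inr (s, h, b)))) = P (some none) ∨
      f (g (σ, .inl (.inr (s, h, b)))) = P (some (some (s, h))) := by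
    intro σ s h b
    obtain ⟨c, hc⟩ := P.surjective (f (g (σ, .inl (.inr (s, h, b)))))
    by_contra! hcon
    refine hne σ σ (.inl (.inl c)) (.inl (.inr (s, h, b))) (hgne _ _ (by simp)) (.inl rfl)
      ⟨?_, ?_⟩ (by rw [hpal', hc])
    · rintro rfl; exact hcon.1 hc.symm
    · rintro rfl; exact hcon.2 hc.symm
  have hbb : ∀ σ τ s h b b', b ≠ b' →
      f (g (σ, .inl (.inr (s, h, b)))) ≠ f (g (τ, .inl (.inr (s, h, b')))) :=
    fun σ τ s h b b' hb =>
      hne _ _ _ _ (hgne _ _ (by simp [hb])) (.inr ⟨rfl, rfl⟩) ⟨rfl, rfl, hb⟩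
  have hB : ∀ s h, ∃ b, ∀ σ, f (g (σ, .inl (.inr (s, h, b)))) = P (some (some (s, h))) := by
    intro s h
    have key : ∀ b, f (g (true, .inl (.inr (s, h, b)))) = P (some none) →
        ∀ σ, f (g (σ, .inl (.inr (s, h, !b)))) = P (some (some (s, h))) := by
      intro b hb σ
      refine (hbit σ s h (!b)).resolve_left fun h' => ?_
      exact hbb true σ s h b (!b) (by simp) (hb.trans h'.symm)
    rcases hbit true s h true with h1 | h1
    · exact ⟨_, key _ h1⟩
    · rcases hbit true s h false with h2 | h2
      · exact ⟨_, key _ h2⟩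
      · exact absurd (h1.trans h2.symm) (hbb _ _ _ _ _ _ (by simp))
  choose B hB using hB
  have hrow : ∀ σ s, f (g (σ, .inr (s, B s))) = P (some none) := by
    intro σ s
    obtain ⟨c, hc⟩ := P.surjective (f (g (σ, .inr (s, B s))))
    have hsel : ∀ h, c ≠ some (some (s, h)) := by
      rintro h rfl
      exact hne σ σ (.inr (s, B s)) (.inl (.inr (s, h, B s h))) (hgne _ _ (by simp)) (.inl rfl)
        ⟨rfl, rfl⟩ (by rw [← hc, hB])
    rw [← hc]
    by_contra hcon
    exact hne σ σ (.inl (.inl c)) (.inr (s, B s)) (hgne _ _ (by simp)) (.inl rfl)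
      ⟨fun h => hcon (by rw [h]), hsel⟩ (by rw [hpal', hc])
  have hin : ∀ σ : Bool, (if σ then x else y) (B false) (B true) = true := by
    intro σ
    by_contra hcon
    exact hne σ σ (.inr (false, B false)) (.inr (true, B true)) (hgne _ _ (by simp)) (.inl rfl)
      ⟨rfl, rfl, by simpa using hcon⟩ (by rw [hrow, hrow])
  exact ⟨B false, B true, hin true, hin false⟩

open scoped Classical in
/-- The coloring of a half that belongs to a selection of one row for each of the two indices. -/
noncomputable def selColor {t : ℕ} (sel : Bool → Fin t → Bool) : Node t → Color t
  | .inl (.inl c) => c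
  | .inl (.inr (s, h, b)) => if b = sel s h then some (some (s, h)) else some none
  | .inr (s, i) => if h : ∃ h, i h ≠ sel s h then some (some (s, h.choose)) else some none

/-- An unselected row takes the color of a position where it deviates from the selection; its
neighboring bit node there has the selection color. -/
theorem selColor_ne {sel : Bool → Fin t → Bool} (hx : x (sel false) (sel true) = true)
    {a b : Node t} (h : colorRel x a b) : selColor sel a ≠ selColor sel b := by
  rcases a with (c | ⟨s, k, b₁⟩) | ⟨s, i⟩ <;> rcases b with (c' | ⟨s', k', b₂⟩) | ⟨s', i'⟩ <;>
    simp only [colorRel] at h <;> simp only [selColor]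
  · exact h
  · split_ifs
    exacts [h.2, h.1]
  · split_ifs
    exacts [h.2 _, h.1]
  · obtain ⟨rfl, rfl, hb⟩ := h
    split_ifs with h1 h2 h2 <;> simp_all
    cases b₁ <;> cases b₂ <;> simp_all
  · obtain ⟨rfl, rfl⟩ := h
    split_ifs with h1 h2 h2
    · intro heq
      simp only [Option.some.injEq, Prod.mk.injEq, true_and] at heq
      have := h1.choose_spec
      rw [heq] at this
      exact this h2
    · simp
    · simp
    · exact absurd ⟨k', h2⟩ h1
  · obtain ⟨rfl, rfl, hi⟩ := h
    split_ifs with h1 h2 h2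
    · simp
    · simp
    · simp
    · push Not at h1 h2
      rw [funext h1, funext h2, hx] at hi
      simp at hi

theorem colorable_glue_of_common {i j : Fin t → Bool} (hx : x i j = true) (hy : y i j = true) :
    (glue colorRel lab x y).Colorable (2 * t + 2) := by
  let sel : Bool → Fin t → Bool := fun s => if s then j else i
  have hsel : ∀ σ : Bool, (if σ then x else y) (sel false) (sel true) = true := by
    rintro (_ | _) <;> simpa [sel]
  rw [← card_color]
  refine (SimpleGraph.Coloring.mk (fun u => selColor sel (lab u).2) ?_).colorable
  intro u v h
  simp only [glue, SimpleGraph.fromRel_adj] at h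
  rcases h.2 with h | h
  · exact selColor_ne (hsel _) h.1
  · exact (selColor_ne (hsel _) h.1).symm

theorem IsLabeling.colorable_glue_iff [Finite W] (hlab : IsLabeling lab) :
    (glue colorRel lab x y).Colorable (2 * t + 2) ↔ ∃ i j, x i j = true ∧ y i j = true := by
  refine ⟨fun h => ?_, fun ⟨i, j, hx, hy⟩ => colorable_glue_of_common hx hy⟩
  rw [← card_color] at h
  exact hlab.exists_common_of_coloring (h.toColoring (by simp))

end Coloring

/-! ### Fooling the network -/

namespace GNN

variable {n p t : ℕ}

/-- If the inputs outnumber the transcripts, then the network has the same output on two glued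
graphs, exactly one of which has a common entry of its two inputs. -/
theorem exists_fooling_glue (N : GNN n p) (a : Fin n → WordVec p (N.dim 0))
    (e : Fin n → Fin n → Fin N.edgeDim → ℝ) {r : Input t → Node t → Node t → Prop}
    (hr : CoreIndep r) {lab : Fin n → Bool × Node t} (hlab : IsLabeling lab) {w : ℕ}
    (hw : N.width ≤ w) (hcard : p * w * ((4 + 12 * t) * N.depth + n) < 4 ^ t) :
    ∃ x y x' y' : Input t, (∃ i j, x i j = true ∧ y i j = true) ∧
      (¬ ∃ i j, x' i j = true ∧ y' i j = true) ∧
      N.output (glue r lab x y) a e = N.output (glue r lab x' y') a e := by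
  have hX : Fintype.card (Input t) = 2 ^ 4 ^ t := by
    simp only [Fintype.card_fun, Fintype.card_bool, Fintype.card_fin, ← pow_mul, ← mul_pow]
    norm_num
  obtain ⟨x, x', hne, -, h₁, h₂⟩ := N.exists_fooling_pair a e (fun u => (lab u).1) (coreSet lab)
    (glue r lab) (fun (x : Input t) i j => !x i j)
    (fun i j x y y' hi => glue_adj_congr_right hr hi j x y y')
    (fun i j x x' y hi => glue_adj_congr_left hr hi j x x' y)
    (fun i j x y => mem_coreSet_of_glue_adj) hw (by
      rw [hX]
      refine Nat.pow_lt_pow_right (by norm_num) (lt_of_le_of_lt ?_ hcard)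
      have := hlab.card_coreSet_le
      gcongr)
  have hdisj : ¬ ∃ i j, x i j = true ∧ (!x i j) = true := by
    rintro ⟨i, j, h, h'⟩
    simp [h] at h'
  obtain ⟨i, j, hij⟩ : ∃ i j, x i j ≠ x' i j := by
    by_contra! h
    exact hne (funext fun i => funext fun j => h i j)
  -- Where `x` and `x'` differ, the input that is `true` meets the complement of the other.
  cases hx : x i j with
  | true =>
    refine ⟨_, _, _, _, ⟨i, j, hx, ?_⟩, hdisj, h₁⟩
    cases hx' : x' i j <;> simp_all
  | false =>
    refine ⟨_, _, _, _, ⟨i, j, ?_, ?_⟩, hdisj, h₂⟩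
    · cases hx' : x' i j <;> simp_all
    · simp [hx]

theorem exists_not_isMaximumIndepSet (N : GNN n p) (a : Fin n → WordVec p (N.dim 0))
    (e : Fin n → Fin n → Fin N.edgeDim → ℝ) (ht : 2 * (2 + 6 * t + 2 * 2 ^ t) ≤ n) {w : ℕ}
    (hw : N.width ≤ w) (hcard : p * w * ((4 + 12 * t) * N.depth + n) < 4 ^ t)
    (A : Set (WordVec p (N.dim N.depth))) :
    ∃ G : SimpleGraph (Fin n), G.Connected ∧ ¬ G.IsMaximumIndepSet (N.selected G a e A) := by
  by_contra! hcon
  obtain ⟨lab, hlab⟩ := exists_isLabeling ht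
  obtain ⟨x, y, x', y', ⟨i, j, hx, hy⟩, hdisj, hout⟩ :=
    N.exists_fooling_glue a e coreIndep_indepRel hlab hw hcard
  have h₁ := hcon _ (hlab.connected_glue hubDominates_indepRel x y)
  have h₂ := hcon _ (hlab.connected_glue hubDominates_indepRel x' y')
  obtain ⟨S, hS, hScard⟩ := hlab.exists_isIndepSet_of_common hx hy
  -- The common entry forces the selected set to have at least `4 * (t + 1)` nodes; the same set
  -- would be independent in the disjoint graph.
  have hle := h₁.maximum S hS
  rw [hScard] at hle
  unfold selected at h₂ hle
  rw [hout] at hle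
  exact hdisj (hlab.exists_common_of_isIndepSet h₂.isIndepSet hle)

theorem exists_not_isMinVertexCover (N : GNN n p) (a : Fin n → WordVec p (N.dim 0))
    (e : Fin n → Fin n → Fin N.edgeDim → ℝ) (ht : 2 * (2 + 6 * t + 2 * 2 ^ t) ≤ n) {w : ℕ}
    (hw : N.width ≤ w) (hcard : p * w * ((4 + 12 * t) * N.depth + n) < 4 ^ t)
    (A : Set (WordVec p (N.dim N.depth))) :
    ∃ G : SimpleGraph (Fin n), G.Connected ∧ ¬ IsMinVertexCover G (N.selected G a e A) := by
  classical
  obtain ⟨G, hG, hnot⟩ := N.exists_not_isMaximumIndepSet a e ht hw hcard Aᶜ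
  refine ⟨G, hG, fun ⟨hcov, hmin⟩ => hnot ?_⟩
  have hcompl : N.selected G a e Aᶜ = (N.selected G a e A)ᶜ := by
    ext i
    simp [selected]
  rw [hcompl]
  refine ⟨?_, fun T hT => ?_⟩
  · rw [Finset.coe_compl]
    exact SimpleGraph.isIndepSet_compl_iff_isVertexCover.2 hcov
  · have := hmin Tᶜ (by
      rw [Finset.coe_compl]
      exact SimpleGraph.isVertexCover_compl.2 hT)
    have h₁ := Finset.card_add_card_compl T
    have h₂ := Finset.card_add_card_compl (N.selected G a e A)
    omega

theorem exists_not_isPerfectColoring (N : GNN n p) (a : Fin n → WordVec p (N.dim 0))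
    (e : Fin n → Fin n → Fin N.edgeDim → ℝ) (ht : 2 * (2 + 6 * t + 2 * 2 ^ t) ≤ n) {w : ℕ}
    (hw : N.width ≤ w) (hcard : p * w * ((4 + 12 * t) * N.depth + n) < 4 ^ t)
    {C : Type} (κ : WordVec p (N.dim N.depth) → C) :
    ∃ G : SimpleGraph (Fin n),
      G.Connected ∧ ¬ IsPerfectColoring G (fun i => κ (N.output G a e i)) := by
  by_contra! hcon
  obtain ⟨lab, hlab⟩ := exists_isLabeling ht
  obtain ⟨x, y, x', y', hcommon, hdisj, hout⟩ :=
    N.exists_fooling_glue a e coreIndep_colorRel hlab hw hcard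
  have h₁ := (hcon _ (hlab.connected_glue hubDominates_colorRel x y)).2
  have h₂ := (hcon _ (hlab.connected_glue hubDominates_colorRel x' y')).2
  -- Equal outputs use equally many colors, so the two chromatic numbers would coincide.
  rw [hout, h₂] at h₁
  refine hdisj (hlab.colorable_glue_iff.1 ?_)
  rw [← SimpleGraph.chromaticNumber_le_iff_colorable, h₁]
  exact SimpleGraph.chromaticNumber_le_iff_colorable.2 (hlab.colorable_glue_iff.2 hcommon)

end GNN

/-! ### Choice of parameters -/

theorem exists_transcript_bound {p : ℕ → ℕ}
    (hp : (fun n : ℕ => (p n : ℝ)) =O[Filter.atTop] (fun n : ℕ => Real.log (n : ℝ))) (w : ℕ) :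
    ∃ c : ℝ, 0 < c ∧ ∃ n₀ : ℕ, ∀ n : ℕ, n₀ ≤ n → ∃ t : ℕ,
      2 * (2 + 6 * t + 2 * 2 ^ t) ≤ n ∧
      ∀ d : ℕ, (d : ℝ) < c * ((n : ℝ) ^ 2 / Real.log (n : ℝ) ^ 2) →
        p n * w * ((4 + 12 * t) * d + n) < 4 ^ t := by
  obtain ⟨C, hC, hpC⟩ := hp.exists_pos
  have hpC := hpC.bound
  -- The `+ 1` keeps `D` positive when `w = 0`.
  set D : ℝ := C * w + 1 with hD
  have hD0 : 0 < D := by positivity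
  have hlog : ∀ᶠ n : ℕ in Filter.atTop, Real.log n ≤ 1 / (32768 * D) * n := by
    have := (Real.isLittleO_log_id_atTop.comp_tendsto tendsto_natCast_atTop_atTop).bound
      (c := 1 / (32768 * D)) (by positivity)
    filter_upwards [this] with n hn
    simpa using (le_abs_self _).trans hn
  obtain ⟨n₀, hn₀⟩ := Filter.eventually_atTop.1
    ((hpC.and hlog).and (Filter.eventually_ge_atTop 64))
  -- `4 + 12 * t ≤ 28 * L` because `t ≤ 2 * L` and `1 ≤ L`. As `32768 = 2 * 128 ^ 2`, each of the
  -- two terms of the transcript length is at most half of `n ^ 2 / 128 ^ 2 < 4 ^ t`.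
  refine ⟨1 / (28 * D * 32768), by positivity, n₀, fun n hn => ?_⟩
  obtain ⟨⟨hpn, hLn⟩, hn64⟩ := hn₀ n hn
  set L := Real.log n with hL
  have hn64' : (64 : ℝ) ≤ n := by exact_mod_cast hn64
  have hL1 : 1 ≤ L := by
    rw [hL, Real.le_log_iff_exp_le (by linarith)]
    linarith [Real.exp_one_lt_d9]
  -- The offset `6` makes room for all labels, while `2 ^ t` stays above `n / 128`.
  obtain ⟨t, ht⟩ : ∃ t, Nat.log 2 n = t + 6 :=
    Nat.exists_eq_add_of_le' (Nat.le_log_of_pow_le (by norm_num) (by simpa using hn64))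
  have hlow : 2 ^ t * 64 ≤ n := by
    have := Nat.pow_log_le_self 2 (show n ≠ 0 by omega)
    rwa [ht, pow_add] at this
  have hupp : n < 2 ^ t * 128 := by
    have := Nat.lt_pow_succ_log_self (b := 2) (by norm_num) n
    rwa [ht, show (t + 6).succ = t + 7 from rfl, pow_add] at this
  have htlt : t < 2 ^ t := Nat.lt_two_pow_self
  refine ⟨t, by omega, fun d hd => ?_⟩
  have htL : (t : ℝ) ≤ 2 * L := by
    have h1 : (t : ℝ) * Real.log 2 ≤ L := by
      rw [hL, ← Real.log_pow]
      refine Real.log_le_log (by positivity) ?_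
      exact_mod_cast (by omega : 2 ^ t ≤ n)
    nlinarith [Real.log_two_gt_d9, (Nat.cast_nonneg t : (0 : ℝ) ≤ t)]
  have hpn' : (p n : ℝ) * w ≤ D * L := by
    have h1 : (p n : ℝ) ≤ C * L := by
      simpa [abs_of_nonneg (zero_le_one.trans hL1)] using hpn
    have : (p n : ℝ) * w ≤ C * L * w := by gcongr
    nlinarith
  have hd' : 28 * D * (L ^ 2 * d) < (n : ℝ) ^ 2 / 32768 := by
    have : L ^ 2 * d < 1 / (28 * D * 32768) * (n : ℝ) ^ 2 := by
      have hL2 : 0 < L ^ 2 := by positivity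
      calc L ^ 2 * d < L ^ 2 * (1 / (28 * D * 32768) * ((n : ℝ) ^ 2 / L ^ 2)) := by gcongr
        _ = _ := by field_simp
    calc 28 * D * (L ^ 2 * d) < 28 * D * (1 / (28 * D * 32768) * (n : ℝ) ^ 2) := by gcongr
      _ = _ := by field_simp
  have hLn' : D * L * n ≤ (n : ℝ) ^ 2 / 32768 := by
    calc D * L * n ≤ D * (1 / (32768 * D) * n) * n := by gcongr
      _ = _ := by field_simp
  have hpow : (n : ℝ) ^ 2 < 4 ^ t * 16384 := by
    have h1 : (n : ℝ) < 2 ^ t * 128 := by exact_mod_cast hupp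
    calc (n : ℝ) ^ 2 < (2 ^ t * 128) ^ 2 := by gcongr
      _ = _ := by rw [mul_pow, ← pow_mul, mul_comm t, pow_mul]; norm_num
  have hfinal : (p n : ℝ) * w * ((4 + 12 * t) * d + n) < 4 ^ t := by
    calc (p n : ℝ) * w * ((4 + 12 * t) * d + n) ≤ D * L * (28 * L * d + n) := by
          have : (4 + 12 * t : ℝ) ≤ 28 * L := by linarith
          gcongr
      _ = 28 * D * (L ^ 2 * d) + D * L * n := by ring
      _ < 4 ^ t := by linarith
  exact_mod_cast hfinal

theorem corollary5 (p : ℕ → ℕ)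
    (hp : (fun n : ℕ => (p n : ℝ)) =Θ[Filter.atTop] (fun n : ℕ => Real.log (n : ℝ)))
    (w : ℕ) :
    ∃ c : ℝ, 0 < c ∧ ∃ n₀ : ℕ, ∀ n : ℕ, n₀ ≤ n →
      ∀ N : GNN n (p n), N.width ≤ w →
        (N.depth : ℝ) < c * ((n : ℝ) ^ 2 / Real.log (n : ℝ) ^ 2) →
        ∀ (a : Fin n → WordVec (p n) (N.dim 0)) (e : Fin n → Fin n → Fin N.edgeDim → ℝ),
          (∀ A : Set (WordVec (p n) (N.dim N.depth)), ∃ G : SimpleGraph (Fin n),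
            G.Connected ∧ ¬ IsMinVertexCover G (N.selected G a e A)) ∧
          (∀ A : Set (WordVec (p n) (N.dim N.depth)), ∃ G : SimpleGraph (Fin n),
            G.Connected ∧ ¬ G.IsMaximumIndepSet (N.selected G a e A)) ∧
          (∀ κ : WordVec (p n) (N.dim N.depth) → ℕ, ∃ G : SimpleGraph (Fin n),
            G.Connected ∧ ¬ IsPerfectColoring G (fun i => κ (N.output G a e i))) := by
  obtain ⟨c, hc, n₀, h⟩ := exists_transcript_bound hp.isBigO w
  refine ⟨c, hc, n₀, fun n hn N hw hd a e => ?_⟩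
  obtain ⟨t, ht, hcard⟩ := h n hn
  have hcard := hcard N.depth hd
  exact ⟨N.exists_not_isMinVertexCover a e ht hw hcard,
    N.exists_not_isMaximumIndepSet a e ht hw hcard,
    N.exists_not_isPerfectColoring a e ht hw hcard⟩
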